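/- Let $N \ge 0$ be an integer and let $\{A(t)\}_{t\ge 0}$, $A(t)=(a_{ij}(t))_{1\le i,j\le N}$, be a chain of real $N\times N$ matrices such that every $A(t)$ has zero row sums and non-negative off-diagonal entries, and every entry $a_{ij}$ is a measurable function that is integrable on every bounded interval $[0,T]$. For $t\ge\tau\ge 0$ let $\Phi(t,\tau)$ be the state transition matrix of $\dot x(t)=A(t)x(t)$, given by the Peano–Baker series $$\Phi(t,\tau)=I+\int_\tau^t A(\sigma_1)\,d\sigma_1+\int_\tau^t A(\sigma_1)\int_\tau^{\sigma_1}A(\sigma_2)\,d\sigma_2\,d\sigma_1+\cdots .$$ For $\tau\ge 0$ let $\mathrm{Null}_\tau(A)=\{v\in\mathbb{R}^N : \lim_{t\to\infty}\Phi(t,\tau)v=0\}$. Then the dimension of $\mathrm{Null}_\tau(A)$ is the same for all $\tau\ge 0$; call it $\mathrm{Nullity}(A)$, and put $\mathrm{Rank}(A)=N-\mathrm{Nullity}(A)$. The unbounded interactions graph of the chain is the directed graph on $\{1,\dots,N\}$ with an edge $i\to j$, for distinct $i,j$, if and only if $\int_0^\infty a_{ji}(t)\,dt=\infty$. An s-root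 of a directed graph is a set $S$ of nodes such that every node is in $S$ or is reachable by a directed path from some node of $S$. Then $\mathrm{Rank}(A)$ is greater than or equal to the size of the smallest s-root of the unbounded interactions graph of $\{A(t)\}$. -/

import Mathlib

open MeasureTheory Filter Topology

namespace OpinionNetwork

/-- A continuous-time chain `{A(t)}` (only the times `t ≥ 0` matter): every `A t` has
non-negative off-diagonal entries and zero row sums, and every entry is a measurable function of
time whose integral over each bounded interval of times is finite (`LocallyIntegrableOn` contains
Lebesgue measurability), so that the dynamics `x' = A(t) x` has a state transition matrix. -/
structure IsTimeChain {N : ℕ} (A : ℝ → Matrix (Fin N) (Fin N) ℝ) : Prop where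
  offDiag_nonneg : ∀ t : ℝ, 0 ≤ t → ∀ i j : Fin N, i ≠ j → 0 ≤ A t i j
  row_sum : ∀ t : ℝ, 0 ≤ t → ∀ i : Fin N, ∑ j, A t i j = 0
  locallyIntegrable : ∀ i j : Fin N,
    LocallyIntegrableOn (fun t : ℝ => A t i j) (Set.Ici 0) volume

/-- The `n`-th term of the Peano–Baker series at `(t, τ)`: the identity matrix for `n = 0`, and
`∫_τ^t A(s) P_n(s, τ) ds` (entrywise) for the term of index `n + 1`. -/
noncomputable def peanoBaker {N : ℕ} (A : ℝ → Matrix (Fin N) (Fin N) ℝ) :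
    ℕ → ℝ → ℝ → Matrix (Fin N) (Fin N) ℝ
  | 0, _, _ => 1
  | n + 1, t, τ => Matrix.of fun i j => ∫ s in τ..t, (A s * peanoBaker A n s τ) i j

/-- The state transition matrix `Φ(t, τ)` of the chain: the sum of the Peano–Baker series. -/
noncomputable def transition {N : ℕ} (A : ℝ → Matrix (Fin N) (Fin N) ℝ) (t τ : ℝ) :
    Matrix (Fin N) (Fin N) ℝ :=
  Matrix.of fun i j => ∑' n : ℕ, peanoBaker A n t τ i j

/-- The null space of the chain at time `τ`: all `v` with `Φ(t, τ) v → 0` as `t → ∞`. -/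
def nullSpace {N : ℕ} (A : ℝ → Matrix (Fin N) (Fin N) ℝ) (τ : ℝ) :
    Submodule ℝ (Fin N → ℝ) where
  carrier := {v | Tendsto (fun t : ℝ => (transition A t τ).mulVec v) atTop (𝓝 0)}
  zero_mem' := by simp
  add_mem' := by
    intro v w hv hw
    simpa [Matrix.mulVec_add] using Tendsto.add hv hw
  smul_mem' := by
    intro c v hv
    simpa [Matrix.mulVec_smul] using Tendsto.const_smul hv c

/-- The nullity of a chain: the dimension of its null spaces, read off at time `0` (the theorem
also asserts that this dimension is the same at all times `τ ≥ 0`). -/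
noncomputable def nullity {N : ℕ} (A : ℝ → Matrix (Fin N) (Fin N) ℝ) : ℕ :=
  Module.finrank ℝ (nullSpace A 0)

/-- The rank of a chain of `N × N` matrices: `N` minus its nullity (which is at most `N`). -/
noncomputable def rank {N : ℕ} (A : ℝ → Matrix (Fin N) (Fin N) ℝ) : ℕ :=
  N - nullity A

/-- The unbounded interactions graph: an edge from `i` to `j ≠ i` iff `∫_0^∞ a_{ji}(t) dt = ∞`. -/
def unboundedInteractions {N : ℕ} (A : ℝ → Matrix (Fin N) (Fin N) ℝ) : Digraph (Fin N) where
  Adj i j := i ≠ j ∧ ∫⁻ t in Set.Ici (0 : ℝ), ENNReal.ofReal (A t j i) = ⊤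

/-- `S` is an s-root of the directed graph `H`: each node lies in `S` or can be reached from a
node of `S` along a directed path. -/
def IsSRoot {V : Type*} (H : Digraph V) (S : Finset V) : Prop :=
  ∀ i : V, i ∈ S ∨ ∃ j ∈ S, Relation.TransGen H.Adj j i

/-- The size of the smallest s-root of a finite directed graph. -/
noncomputable def minSRootSize {V : Type*} (H : Digraph V) : ℕ :=
  sInf {n : ℕ | ∃ S : Finset V, IsSRoot H S ∧ S.card = n}

/-- On a finite graph the size of the smallest s-root is attained. -/
theorem exists_isSRoot_card_eq {V : Type*} [Fintype V] (H : Digraph V) :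
    ∃ S : Finset V, IsSRoot H S ∧ S.card = minSRootSize H :=
  Nat.sInf_mem (s := {n : ℕ | ∃ S : Finset V, IsSRoot H S ∧ S.card = n})
    ⟨_, Finset.univ, fun i => Or.inl (Finset.mem_univ i), rfl⟩

end OpinionNetwork

/-!
The Dyson series of a path in a Banach algebra solves `X' = A X` and satisfies the cocycle identity
`Φ(t, s) Φ(s, τ) = Φ(t, τ)`. Hence `Φ(σ, τ)` is invertible and maps the null space at time `τ`
onto the null space at time `σ`, so their dimensions agree.

In an s-root of smallest size, the sets of ancestors of two members are disjoint, since a common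
ancestor could replace both. No edge of the unbounded interactions graph enters such a set `K`, so
the total weight with which the outside acts on `K` is integrable over time, and from a late time
`τ` on its integral is at most `1 / 4`. By a minimum principle, a trajectory started at time `τ` in
the indicator of `K` stays in `[0, 1]` everywhere and above `3 / 4` on `K`. The indicators of the
disjoint sets add up to at most `1`, so reading their trajectories off at one node per set gives a
matrix that is diagonally dominant with a uniform gap of `1 / 2`. Thus no nonzero combination of
the indicators lies in the null space at time `τ`, whose codimension is therefore at least the
number of sets.
-/

namespace OpinionNetwork

section IntervalIntegrals

theorem absolutelyContinuousOnInterval_pow {f : ℝ → ℝ} {a b : ℝ}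
    (hf : AbsolutelyContinuousOnInterval f a b) (n : ℕ) :
    AbsolutelyContinuousOnInterval (fun s => f s ^ n) a b := by
  induction n with
  | zero =>
    simpa only [pow_zero] using
      ((LipschitzWith.const (1 : ℝ)).lipschitzOnWith).absolutelyContinuousOnInterval
  | succ n ih => simpa only [pow_succ] using ih.fun_mul hf

theorem integral_mul_primitive_pow {g : ℝ → ℝ} {a b : ℝ}
    (hg : IntervalIntegrable g volume a b) (n : ℕ) :
    ∫ s in a..b, g s * (∫ u in a..s, g u) ^ n = (∫ u in a..b, g u) ^ (n + 1) / (n + 1) := by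
  have hac := absolutelyContinuousOnInterval_pow
    (hg.absolutelyContinuousOnInterval_intervalIntegral Set.left_mem_uIcc) (n + 1)
  have hderiv : ∀ᵐ s, s ∈ Set.uIoc a b →
      deriv (fun s => (∫ u in a..s, g u) ^ (n + 1)) s =
        (n + 1) * (g s * (∫ u in a..s, g u) ^ n) := by
    filter_upwards [hg.ae_hasDerivAt_integral] with s hs hsab
    have := ((hs (Set.uIoc_subset_uIcc hsab) a Set.left_mem_uIcc).fun_pow (n + 1)).deriv
    rw [this]
    push_cast
    ring
  have hftc := hac.integral_deriv_eq_sub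
  rw [intervalIntegral.integral_congr_ae hderiv, intervalIntegral.integral_const_mul,
    intervalIntegral.integral_same, zero_pow n.succ_ne_zero, sub_zero] at hftc
  rw [← hftc, mul_div_cancel_left₀ _ (by positivity)]

theorem abs_integral_mul_abs_primitive_pow {g : ℝ → ℝ} {a b : ℝ}
    (hg : IntervalIntegrable g volume a b) (h0 : ∀ s, 0 ≤ g s) (n : ℕ) :
    |∫ s in a..b, g s * |∫ u in a..s, g u| ^ n| = |∫ u in a..b, g u| ^ (n + 1) / (n + 1) := by
  obtain ⟨c, hc, hsign⟩ : ∃ c : ℝ, |c| = 1 ∧ ∀ s ∈ Set.uIcc a b,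
      |∫ u in a..s, g u| = c * ∫ u in a..s, g u := by
    rcases le_total a b with h | h
    · refine ⟨1, by simp, fun s hs => ?_⟩
      rw [Set.uIcc_of_le h] at hs
      rw [one_mul, abs_of_nonneg (intervalIntegral.integral_nonneg_of_forall hs.1 h0)]
    · refine ⟨-1, by simp, fun s hs => ?_⟩
      rw [Set.uIcc_of_ge h] at hs
      rw [neg_one_mul, intervalIntegral.integral_symm, abs_neg, neg_neg,
        abs_of_nonneg (intervalIntegral.integral_nonneg_of_forall hs.2 h0)]
  calc |∫ s in a..b, g s * |∫ u in a..s, g u| ^ n|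
      = |∫ s in a..b, c ^ n * (g s * (∫ u in a..s, g u) ^ n)| := by
        congr 1
        refine intervalIntegral.integral_congr fun s hs => ?_
        simp only [hsign s hs]
        ring
    _ = |∫ u in a..b, g u| ^ (n + 1) / (n + 1) := by
        rw [intervalIntegral.integral_const_mul, integral_mul_primitive_pow hg, abs_mul, abs_pow,
          hc, one_pow, one_mul, abs_div, abs_pow, abs_of_pos (by positivity : (0 : ℝ) < n + 1)]

theorem intervalIntegrable_of_locallyIntegrableOn_Ici {E : Type*} [NormedAddCommGroup E]
    {f : ℝ → E} {a b c : ℝ} (hf : LocallyIntegrableOn f (Set.Ici c)) (ha : c ≤ a) (hb : c ≤ b) :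
    IntervalIntegrable f volume a b :=
  ((hf.mono_set fun _ hx => (le_inf ha hb).trans hx.1).integrableOn_isCompact
    isCompact_uIcc).intervalIntegrable

theorem eventually_forall_ge_norm_integral_le {E : Type*} [NormedAddCommGroup E]
    [NormedSpace ℝ E] {f : ℝ → E} {a ε : ℝ} (hf : IntegrableOn f (Set.Ioi a)) (hε : 0 < ε) :
    ∀ᶠ s in atTop, ∀ t, s ≤ t → ‖∫ u in s..t, f u‖ ≤ ε := by
  have hint {t : ℝ} (ht : a ≤ t) : IntervalIntegrable f volume a t :=
    (intervalIntegrable_iff_integrableOn_Ioc_of_le ht).2 (hf.mono_set Set.Ioc_subset_Ioi_self)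
  have hclose := (intervalIntegral_tendsto_integral_Ioi a hf tendsto_id).eventually
    (Metric.ball_mem_nhds _ (half_pos hε))
  filter_upwards [eventually_forall_ge_atTop.2 hclose, eventually_ge_atTop a] with s hs has t hst
  rw [← intervalIntegral.integral_interval_sub_left (hint (has.trans hst)) (hint has),
    ← dist_eq_norm]
  exact (dist_triangle_right _ _ _).trans
    ((add_lt_add (hs t hst) (hs s le_rfl)).trans_eq (add_halves ε)).le

end IntervalIntegrals

section TimeOrderedExp

variable {R : Type*} [NormedRing R] [NormedAlgebra ℝ R]

/-- The `n`-th term of the Dyson (Peano–Baker) series of a path `A` in a Banach algebra, as a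
Bochner integral. For matrices this is `peanoBaker`, see `toOperator_peanoBaker`; the algebraic
form makes norm estimates and products available. -/
noncomputable def dysonTerm (A : ℝ → R) : ℕ → ℝ → ℝ → R
  | 0, _, _ => 1
  | n + 1, t, τ => ∫ s in τ..t, A s * dysonTerm A n s τ

/-- The time-ordered exponential of a path in a Banach algebra: the sum of its Dyson series, which
solves `X' = A X` with `X = 1` at time `τ`. -/
noncomputable def timeOrderedExp (A : ℝ → R) (t τ : ℝ) : R :=
  ∑' n : ℕ, dysonTerm A n t τ

variable {A : ℝ → R} {a b s t τ : ℝ}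

theorem continuousOn_dysonTerm (hA : IntervalIntegrable A volume a b) (hτ : τ ∈ Set.uIcc a b)
    (n : ℕ) : ContinuousOn (fun t => dysonTerm A n t τ) (Set.uIcc a b) := by
  induction n with
  | zero => exact continuousOn_const
  | succ n ih => exact intervalIntegral.continuousOn_primitive_interval' (hA.mul_continuousOn ih) hτ

theorem intervalIntegrable_mul_dysonTerm (hA : IntervalIntegrable A volume a b)
    (hτ : τ ∈ Set.uIcc a b) (hs : s ∈ Set.uIcc a b) (ht : t ∈ Set.uIcc a b) (n : ℕ) :
    IntervalIntegrable (fun u => A u * dysonTerm A n u τ) volume s t :=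
  (hA.mul_continuousOn (continuousOn_dysonTerm hA hτ n)).mono_set (Set.uIcc_subset_uIcc hs ht)

theorem norm_dysonTerm_le (hA : IntervalIntegrable A volume a b) (ht : t ∈ Set.uIcc a b)
    (hτ : τ ∈ Set.uIcc a b) (n : ℕ) :
    ‖dysonTerm A n t τ‖ ≤ ‖(1 : R)‖ * (|∫ s in τ..t, ‖A s‖| ^ n / n.factorial) := by
  induction n generalizing t with
  | zero => simp [dysonTerm]
  | succ n ih =>
    have hsub : Set.uIcc τ t ⊆ Set.uIcc a b := Set.uIcc_subset_uIcc hτ ht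
    have hnorm : IntervalIntegrable (fun s => ‖A s‖) volume τ t := (hA.mono_set hsub).norm
    have hcont : ContinuousOn (fun s => |∫ u in τ..s, ‖A u‖| ^ n) (Set.uIcc τ t) :=
      (intervalIntegral.continuousOn_primitive_interval' hnorm Set.left_mem_uIcc).abs.pow n
    have hbound : ∀ᵐ s ∂volume.restrict (Set.uIoc τ t), ‖A s * dysonTerm A n s τ‖ ≤
        (‖(1 : R)‖ / n.factorial) * (‖A s‖ * |∫ u in τ..s, ‖A u‖| ^ n) := by
      refine (ae_restrict_iff' measurableSet_uIoc).2 (Eventually.of_forall fun s hs => ?_)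
      calc ‖A s * dysonTerm A n s τ‖
          ≤ ‖A s‖ * (‖(1 : R)‖ * (|∫ u in τ..s, ‖A u‖| ^ n / n.factorial)) :=
            norm_mul_le_of_le le_rfl (ih (hsub (Set.uIoc_subset_uIcc hs)))
        _ = _ := by ring
    calc ‖∫ s in τ..t, A s * dysonTerm A n s τ‖
        ≤ |∫ s in τ..t, (‖(1 : R)‖ / n.factorial) * (‖A s‖ * |∫ u in τ..s, ‖A u‖| ^ n)| :=
          intervalIntegral.norm_integral_le_abs_of_norm_le hbound
            ((hnorm.mul_continuousOn hcont).const_mul _)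
      _ = ‖(1 : R)‖ * (|∫ s in τ..t, ‖A s‖| ^ (n + 1) / (n + 1).factorial) := by
          rw [intervalIntegral.integral_const_mul, abs_mul,
            abs_integral_mul_abs_primitive_pow hnorm (fun _ => norm_nonneg _),
            abs_of_nonneg (by positivity), Nat.factorial_succ]
          push_cast
          field_simp

theorem norm_dysonTerm_le_uniform (hA : IntervalIntegrable A volume a b) (ht : t ∈ Set.uIcc a b)
    (hτ : τ ∈ Set.uIcc a b) (n : ℕ) :
    ‖dysonTerm A n t τ‖ ≤ ‖(1 : R)‖ * (|∫ s in a..b, ‖A s‖| ^ n / n.factorial) := by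
  have hmono : |∫ s in τ..t, ‖A s‖| ≤ |∫ s in a..b, ‖A s‖| :=
    intervalIntegral.abs_integral_mono_interval
      (Set.uIoc_subset_uIoc_of_uIcc_subset_uIcc (Set.uIcc_subset_uIcc hτ ht))
      (Eventually.of_forall fun _ => norm_nonneg _) hA.norm
  refine (norm_dysonTerm_le hA ht hτ n).trans ?_
  gcongr

theorem summable_norm_dysonTerm (hA : IntervalIntegrable A volume a b) (ht : t ∈ Set.uIcc a b)
    (hτ : τ ∈ Set.uIcc a b) : Summable fun n => ‖dysonTerm A n t τ‖ :=
  .of_nonneg_of_le (fun _ => norm_nonneg _) (norm_dysonTerm_le_uniform hA ht hτ)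
    ((Real.summable_pow_div_factorial _).mul_left _)

theorem integral_mul_const_of_intervalIntegrable {f : ℝ → R}
    (hf : IntervalIntegrable f volume a b) (c : R) :
    ∫ s in a..b, f s * c = (∫ s in a..b, f s) * c := by
  simp only [intervalIntegral, sub_mul, integral_mul_const_of_integrable hf.1,
    integral_mul_const_of_integrable hf.2]

open Finset.HasAntidiagonal in
/-- Chen's identity. As the Dyson series converge absolutely, summing it over `n` yields the cocycle
property `timeOrderedExp_mul_timeOrderedExp`. -/
theorem dysonTerm_eq_sum_antidiagonal (hA : IntervalIntegrable A volume a b)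
    (hs : s ∈ Set.uIcc a b) (ht : t ∈ Set.uIcc a b) (hτ : τ ∈ Set.uIcc a b) (n : ℕ) :
    dysonTerm A n t τ =
      ∑ p ∈ antidiagonal n, dysonTerm A p.1 t s * dysonTerm A p.2 s τ := by
  induction n generalizing t with
  | zero => simp [dysonTerm]
  | succ n ih =>
    have hint := fun p : ℕ × ℕ => intervalIntegrable_mul_dysonTerm hA hs hs ht p.1
    have hstep : ∫ u in s..t, A u * dysonTerm A n u τ =
        ∑ p ∈ antidiagonal n, dysonTerm A (p.1 + 1) t s * dysonTerm A p.2 s τ := by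
      calc ∫ u in s..t, A u * dysonTerm A n u τ
          = ∫ u in s..t, ∑ p ∈ antidiagonal n,
              A u * dysonTerm A p.1 u s * dysonTerm A p.2 s τ := by
            refine intervalIntegral.integral_congr fun u hu => ?_
            simp only [ih (Set.uIcc_subset_uIcc hs ht hu), Finset.mul_sum, mul_assoc]
        _ = _ := by
            rw [intervalIntegral.integral_finsetSum fun p _ => (hint p).mul_const _]
            exact Finset.sum_congr rfl fun p _ =>
              integral_mul_const_of_intervalIntegrable (hint p) _
    calc dysonTerm A (n + 1) t τ
        = dysonTerm A (n + 1) s τ + ∫ u in s..t, A u * dysonTerm A n u τ :=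
          (intervalIntegral.integral_add_adjacent_intervals
            (intervalIntegrable_mul_dysonTerm hA hτ hτ hs n)
            (intervalIntegrable_mul_dysonTerm hA hτ hs ht n)).symm
      _ = _ := by
          rw [hstep, Finset.Nat.sum_antidiagonal_succ]
          simp only [dysonTerm, one_mul]

theorem timeOrderedExp_self (A : ℝ → R) (τ : ℝ) : timeOrderedExp A τ τ = 1 := by
  rw [timeOrderedExp, tsum_eq_single 0]
  · rfl
  · rintro (_ | n) hn
    · exact absurd rfl hn
    · exact intervalIntegral.integral_same

variable [CompleteSpace R]

theorem hasSum_dysonTerm (hA : IntervalIntegrable A volume a b) (ht : t ∈ Set.uIcc a b)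
    (hτ : τ ∈ Set.uIcc a b) : HasSum (fun n => dysonTerm A n t τ) (timeOrderedExp A t τ) :=
  (summable_norm_dysonTerm hA ht hτ).of_norm.hasSum

theorem continuousOn_timeOrderedExp (hA : IntervalIntegrable A volume a b)
    (hτ : τ ∈ Set.uIcc a b) : ContinuousOn (fun t => timeOrderedExp A t τ) (Set.uIcc a b) :=
  continuousOn_tsum (continuousOn_dysonTerm hA hτ)
    ((Real.summable_pow_div_factorial _).mul_left _)
    fun n _ ht => norm_dysonTerm_le_uniform hA ht hτ n

theorem hasSum_dysonTerm_succ (hA : IntervalIntegrable A volume a b) (ht : t ∈ Set.uIcc a b)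
    (hτ : τ ∈ Set.uIcc a b) :
    HasSum (fun n => dysonTerm A (n + 1) t τ) (∫ s in τ..t, A s * timeOrderedExp A s τ) := by
  have hsub : Set.uIoc τ t ⊆ Set.uIcc a b :=
    Set.uIoc_subset_uIcc.trans (Set.uIcc_subset_uIcc hτ ht)
  obtain ⟨c, hc, hle⟩ : ∃ c : ℕ → ℝ, Summable c ∧
      ∀ n, ∀ s ∈ Set.uIcc a b, ‖dysonTerm A n s τ‖ ≤ c n :=
    ⟨_, (Real.summable_pow_div_factorial _).mul_left _,
      fun n _ hs => norm_dysonTerm_le_uniform hA hs hτ n⟩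
  refine intervalIntegral.hasSum_integral_of_dominated_convergence (fun n s => ‖A s‖ * c n)
    (fun n => (intervalIntegrable_iff.1
      (intervalIntegrable_mul_dysonTerm hA hτ hτ ht n)).aestronglyMeasurable)
    (fun n => .of_forall fun s hs => norm_mul_le_of_le le_rfl (hle n s (hsub hs)))
    (.of_forall fun s _ => hc.mul_left _) ?_
    (.of_forall fun s hs => (hasSum_dysonTerm hA (hsub hs) hτ).mul_left _)
  simp only [tsum_mul_left]
  exact (hA.mono_set (Set.uIcc_subset_uIcc hτ ht)).norm.mul_const _

theorem timeOrderedExp_eq_one_add_integral (hA : IntervalIntegrable A volume a b)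
    (ht : t ∈ Set.uIcc a b) (hτ : τ ∈ Set.uIcc a b) :
    timeOrderedExp A t τ = 1 + ∫ s in τ..t, A s * timeOrderedExp A s τ := by
  rw [← (hasSum_dysonTerm_succ hA ht hτ).tsum_eq, timeOrderedExp,
    (hasSum_dysonTerm hA ht hτ).summable.tsum_eq_zero_add, dysonTerm]

theorem timeOrderedExp_sub_timeOrderedExp (hA : IntervalIntegrable A volume a b)
    (hs : s ∈ Set.uIcc a b) (ht : t ∈ Set.uIcc a b) (hτ : τ ∈ Set.uIcc a b) :
    timeOrderedExp A t τ - timeOrderedExp A s τ = ∫ u in s..t, A u * timeOrderedExp A u τ := by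
  have hint : ∀ r ∈ Set.uIcc a b,
      IntervalIntegrable (fun u => A u * timeOrderedExp A u τ) volume τ r := fun r hr =>
    (hA.mul_continuousOn (continuousOn_timeOrderedExp hA hτ)).mono_set
      (Set.uIcc_subset_uIcc hτ hr)
  rw [timeOrderedExp_eq_one_add_integral hA ht hτ, timeOrderedExp_eq_one_add_integral hA hs hτ,
    add_sub_add_left_eq_sub, intervalIntegral.integral_interval_sub_left (hint t ht) (hint s hs)]

theorem timeOrderedExp_mul_timeOrderedExp (hA : IntervalIntegrable A volume a b)
    (hs : s ∈ Set.uIcc a b) (ht : t ∈ Set.uIcc a b) (hτ : τ ∈ Set.uIcc a b) :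
    timeOrderedExp A t s * timeOrderedExp A s τ = timeOrderedExp A t τ := by
  rw [timeOrderedExp, timeOrderedExp, tsum_mul_tsum_eq_tsum_sum_antidiagonal_of_summable_norm
    (summable_norm_dysonTerm hA ht hs) (summable_norm_dysonTerm hA hs hτ)]
  exact tsum_congr fun n => (dysonTerm_eq_sum_antidiagonal hA hs ht hτ n).symm

end TimeOrderedExp

section Transition

open scoped Matrix

/-- A real square matrix as a continuous linear operator on `ι → ℝ` with the sup norm; this is the
Banach algebra in which the Peano–Baker series is summed. -/
noncomputable def toOperator {ι : Type*} [Fintype ι] [DecidableEq ι] :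
    Matrix ι ι ℝ ≃ₐ[ℝ] ((ι → ℝ) →L[ℝ] (ι → ℝ)) :=
  Matrix.toLinAlgEquiv'.trans (Module.End.toContinuousLinearMap (ι → ℝ))

section Operator

variable {ι : Type*} [Fintype ι] [DecidableEq ι] {a b : ℝ}

@[simp]
theorem toOperator_apply (M : Matrix ι ι ℝ) (v : ι → ℝ) : toOperator M v = M *ᵥ v := rfl

theorem intervalIntegrable_toOperator {B : ℝ → Matrix ι ι ℝ}
    (hB : ∀ i j, IntervalIntegrable (fun t => B t i j) volume a b) :
    IntervalIntegrable (fun t => toOperator (B t)) volume a b := by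
  have h := IntervalIntegrable.sum Finset.univ fun i _ => IntervalIntegrable.sum Finset.univ
    fun j _ => (hB i j).smul_continuousOn (continuousOn_const (c := toOperator (.single i j 1)))
  refine h.congr fun t _ => ?_
  conv_rhs => rw [Matrix.matrix_eq_sum_single (B t)]
  simp only [Finset.sum_apply, map_sum, ← map_smul, Matrix.smul_single, smul_eq_mul, mul_one]

end Operator

theorem integral_operator_apply {ι : Type*} [Fintype ι] {F : ℝ → (ι → ℝ) →L[ℝ] (ι → ℝ)} {a b : ℝ}
    (hF : IntervalIntegrable F volume a b) (v : ι → ℝ) (i : ι) :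
    (∫ t in a..b, F t) v i = ∫ t in a..b, F t v i :=
  (((ContinuousLinearMap.proj (R := ℝ) (φ := fun _ : ι => ℝ) i).comp
    (ContinuousLinearMap.apply ℝ (ι → ℝ) v)).intervalIntegral_comp_comm hF).symm

theorem operator_ext {ι : Type*} [Finite ι] [DecidableEq ι] {F G : (ι → ℝ) →L[ℝ] (ι → ℝ)}
    (h : ∀ i j, F (Pi.single j 1) i = G (Pi.single j 1) i) : F = G :=
  ContinuousLinearMap.coe_injective <| LinearMap.pi_ext' fun j =>
    LinearMap.ext_ring <| funext fun i => h i j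

variable {N : ℕ} {A : ℝ → Matrix (Fin N) (Fin N) ℝ} {a b s t τ : ℝ}

theorem toOperator_peanoBaker (hA : IntervalIntegrable (fun t => toOperator (A t)) volume a b)
    (ht : t ∈ Set.uIcc a b) (hτ : τ ∈ Set.uIcc a b) (n : ℕ) :
    toOperator (peanoBaker A n t τ) = dysonTerm (fun t => toOperator (A t)) n t τ := by
  induction n generalizing t with
  | zero => exact map_one _
  | succ n ih =>
    refine operator_ext fun i j => ?_
    rw [dysonTerm, integral_operator_apply (intervalIntegrable_mul_dysonTerm hA hτ hτ ht n),
      toOperator_apply, Matrix.mulVec_single_one]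
    refine intervalIntegral.integral_congr fun s hs => ?_
    simp only [← ih (Set.uIcc_subset_uIcc hτ ht hs), ← map_mul, toOperator_apply,
      Matrix.mulVec_single_one, Matrix.col_apply]

theorem toOperator_transition (hA : IntervalIntegrable (fun t => toOperator (A t)) volume a b)
    (ht : t ∈ Set.uIcc a b) (hτ : τ ∈ Set.uIcc a b) :
    toOperator (transition A t τ) = timeOrderedExp (fun t => toOperator (A t)) t τ := by
  refine operator_ext fun i j => ?_
  have hsum := ((hasSum_dysonTerm hA ht hτ).mapL
    ((ContinuousLinearMap.proj (R := ℝ) (φ := fun _ : Fin N => ℝ) i).comp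
      (ContinuousLinearMap.apply ℝ (Fin N → ℝ) (Pi.single j 1))))
  simp only [← toOperator_peanoBaker hA ht hτ] at hsum
  simpa [transition] using hsum.tsum_eq

theorem transition_mul_transition
    (hA : IntervalIntegrable (fun t => toOperator (A t)) volume a b)
    (hs : s ∈ Set.uIcc a b) (ht : t ∈ Set.uIcc a b) (hτ : τ ∈ Set.uIcc a b) :
    transition A t s * transition A s τ = transition A t τ := by
  apply toOperator.injective
  rw [map_mul, toOperator_transition hA ht hs, toOperator_transition hA hs hτ,
    toOperator_transition hA ht hτ, timeOrderedExp_mul_timeOrderedExp hA hs ht hτ]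

theorem transition_self (A : ℝ → Matrix (Fin N) (Fin N) ℝ) (τ : ℝ) : transition A τ τ = 1 := by
  apply toOperator.injective
  rw [toOperator_transition (IntervalIntegrable.refl (a := τ)) Set.left_mem_uIcc Set.left_mem_uIcc,
    timeOrderedExp_self, map_one]

theorem continuousOn_transition_mulVec
    (hA : IntervalIntegrable (fun t => toOperator (A t)) volume a b) (hτ : τ ∈ Set.uIcc a b)
    (v : Fin N → ℝ) : ContinuousOn (fun t => transition A t τ *ᵥ v) (Set.uIcc a b) := by
  refine ((continuousOn_timeOrderedExp hA hτ).clm_apply (continuousOn_const (c := v))).congr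
    fun t ht => ?_
  simp only [← toOperator_transition hA ht hτ, toOperator_apply]

theorem transition_mulVec_sub (hA : IntervalIntegrable (fun t => toOperator (A t)) volume a b)
    (hs : s ∈ Set.uIcc a b) (ht : t ∈ Set.uIcc a b) (hτ : τ ∈ Set.uIcc a b) (v : Fin N → ℝ)
    (i : Fin N) :
    (transition A t τ *ᵥ v) i - (transition A s τ *ᵥ v) i =
      ∫ u in s..t, ∑ j, A u i j * (transition A u τ *ᵥ v) j := by
  have hint := (hA.mul_continuousOn (continuousOn_timeOrderedExp hA hτ)).mono_set
    (Set.uIcc_subset_uIcc hs ht)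
  rw [← toOperator_apply, ← toOperator_apply, ← Pi.sub_apply, ← sub_apply,
    toOperator_transition hA ht hτ, toOperator_transition hA hs hτ,
    timeOrderedExp_sub_timeOrderedExp hA hs ht hτ, integral_operator_apply hint]
  refine intervalIntegral.integral_congr fun u hu => ?_
  simp only [← toOperator_transition hA (Set.uIcc_subset_uIcc hs ht hu) hτ,
    mul_apply_eq_comp, toOperator_apply]
  rfl

end Transition

section NullSpace

open scoped Matrix

variable {N : ℕ} {A : ℝ → Matrix (Fin N) (Fin N) ℝ} {s t σ τ : ℝ}

theorem transition_mul_transition_of_nonneg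
    (hA : ∀ i j, LocallyIntegrableOn (fun t => A t i j) (Set.Ici 0))
    (hs : 0 ≤ s) (ht : 0 ≤ t) (hτ : 0 ≤ τ) :
    transition A t s * transition A s τ = transition A t τ := by
  have hb : 0 ≤ s ⊔ t ⊔ τ := le_sup_of_le_right hτ
  refine transition_mul_transition (a := 0) (b := s ⊔ t ⊔ τ) (intervalIntegrable_toOperator
    fun i j => intervalIntegrable_of_locallyIntegrableOn_Ici (hA i j) le_rfl hb) ?_ ?_ ?_ <;>
  simp only [Set.uIcc_of_le hb, Set.mem_Icc, le_sup_iff, le_refl, true_or, or_true, and_true] <;>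
  assumption

theorem mem_nullSpace_iff (hA : ∀ i j, LocallyIntegrableOn (fun t => A t i j) (Set.Ici 0))
    (hσ : 0 ≤ σ) (hτ : 0 ≤ τ) {v : Fin N → ℝ} :
    v ∈ nullSpace A τ ↔ transition A σ τ *ᵥ v ∈ nullSpace A σ := by
  refine tendsto_congr' ?_
  filter_upwards [eventually_ge_atTop 0] with t ht
  rw [Matrix.mulVec_mulVec, transition_mul_transition_of_nonneg hA hσ ht hτ]

theorem finrank_nullSpace_eq (hA : ∀ i j, LocallyIntegrableOn (fun t => A t i j) (Set.Ici 0))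
    (hσ : 0 ≤ σ) (hτ : 0 ≤ τ) :
    Module.finrank ℝ (nullSpace A τ) = Module.finrank ℝ (nullSpace A σ) := by
  let e : (Fin N → ℝ) ≃ₗ[ℝ] (Fin N → ℝ) := Matrix.toLin'OfInv
    ((transition_mul_transition_of_nonneg hA hσ hτ hτ).trans (transition_self A τ))
    ((transition_mul_transition_of_nonneg hA hτ hσ hσ).trans (transition_self A σ))
  have hcomap : nullSpace A τ = (nullSpace A σ).comap (e : (Fin N → ℝ) →ₗ[ℝ] (Fin N → ℝ)) :=
    Submodule.ext fun v => by
      rw [mem_nullSpace_iff hA hσ hτ, ← Matrix.toLin'_apply]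
      rfl
  rw [hcomap]
  exact (e.ofSubmodule' (nullSpace A σ)).finrank_eq

end NullSpace

section MinimumPrinciple

variable {ι : Type*} [Fintype ι] {B : ℝ → Matrix ι ι ℝ} {a b s t ε c : ℝ} {x : ℝ → ι → ℝ}

/-- `x` satisfies `x_i' ≥ ∑ j, B_ij (x_j - x_i)` on `[a, b]`. As the coefficients are only
integrable in time, the inequality is imposed on the increments of `x`. -/
structure IsSupersolution (B : ℝ → Matrix ι ι ℝ) (a b : ℝ) (x : ℝ → ι → ℝ) : Prop where
  continuousOn : ContinuousOn x (Set.Icc a b)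
  integral_le : ∀ i s t, a ≤ s → s ≤ t → t ≤ b →
    ∫ u in s..t, ∑ j, B u i j * (x u j - x u i) ≤ x t i - x s i

/-- The sum of the absolute values of all entries of a matrix, the rate at which the minimum
principle perturbs a supersolution to make its minimum strict. -/
def sumAbs (M : Matrix ι ι ℝ) : ℝ := ∑ i, ∑ j, |M i j|

theorem sum_abs_row_le_sumAbs (M : Matrix ι ι ℝ) (i : ι) : ∑ j, |M i j| ≤ sumAbs M :=
  Finset.single_le_sum (f := fun i => ∑ j, |M i j|)
    (fun _ _ => Finset.sum_nonneg fun _ _ => abs_nonneg _) (Finset.mem_univ i)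

theorem intervalIntegrable_sumAbs (hB : ∀ i j, IntervalIntegrable (fun t => B t i j) volume a b) :
    IntervalIntegrable (fun t => sumAbs (B t)) volume a b := by
  have h := IntervalIntegrable.sum Finset.univ fun i _ =>
    IntervalIntegrable.sum Finset.univ fun j _ => (hB i j).abs
  exact h.congr fun t _ => by simp only [sumAbs, Finset.sum_apply]

namespace IsSupersolution

theorem neg_mul_integral_sumAbs_le (hx : IsSupersolution B a b x)
    (hB : ∀ t ∈ Set.Icc a b, ∀ i j, i ≠ j → 0 ≤ B t i j)
    (hint : ∀ i j, IntervalIntegrable (fun t => B t i j) volume a b)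
    (has : a ≤ s) (hst : s ≤ t) (htb : t ≤ b) (hε : 0 ≤ ε) {i : ι}
    (hi : ∀ u ∈ Set.Icc s t, ∀ j, x u i - ε ≤ x u j) :
    -(ε * ∫ u in s..t, sumAbs (B u)) ≤ x t i - x s i := by
  have hsub : Set.Icc s t ⊆ Set.Icc a b := Set.Icc_subset_Icc has htb
  have hmono {f : ℝ → ℝ} (hf : IntervalIntegrable f volume a b) :
      IntervalIntegrable f volume s t :=
    hf.mono_set (by rwa [Set.uIcc_of_le hst, Set.uIcc_of_le (has.trans (hst.trans htb))])
  have hdiff (j : ι) : ContinuousOn (fun u => x u j - x u i) (Set.uIcc s t) := by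
    rw [Set.uIcc_of_le hst]
    have hc := continuousOn_pi.1 hx.continuousOn
    exact ((hc j).sub (hc i)).mono hsub
  have hterm (u : ℝ) (hu : u ∈ Set.Icc s t) (j : ι) :
      -(ε * |B u i j|) ≤ B u i j * (x u j - x u i) := by
    rcases eq_or_ne i j with rfl | hij
    · simpa using mul_nonneg hε (abs_nonneg (B u i i))
    · rw [abs_of_nonneg (hB u (hsub hu) i j hij)]
      nlinarith [hB u (hsub hu) i j hij, hi u hu j]
  calc -(ε * ∫ u in s..t, sumAbs (B u)) = ∫ u in s..t, -(ε * sumAbs (B u)) := by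
        rw [intervalIntegral.integral_neg, intervalIntegral.integral_const_mul]
    _ ≤ ∫ u in s..t, ∑ j, B u i j * (x u j - x u i) := by
        refine intervalIntegral.integral_mono_on hst
          ((hmono (intervalIntegrable_sumAbs hint)).const_mul ε).neg
          (by simpa only [Finset.sum_fn] using IntervalIntegrable.sum Finset.univ fun j _ =>
            (hmono (hint i j)).mul_continuousOn (hdiff j)) fun u hu => ?_
        calc -(ε * sumAbs (B u)) ≤ -(ε * ∑ j, |B u i j|) := by
              gcongr
              exact sum_abs_row_le_sumAbs _ _
          _ = ∑ j, -(ε * |B u i j|) := by rw [Finset.mul_sum, Finset.sum_neg_distrib]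
          _ ≤ _ := Finset.sum_le_sum fun j _ => hterm u hu j
    _ ≤ x t i - x s i := hx.integral_le i s t has hst htb

/-- Just before a minimum of `z` over all times and indices, the other coordinates pull the minimal
one down at a rate of at most `ε * sumAbs B`, less than the rate at which the perturbation raises
it. So `z` would have been smaller shortly before, unless the minimum is attained at time `a`. -/
theorem eq_left_of_isMin (hx : IsSupersolution B a b x)
    (hB : ∀ t ∈ Set.Icc a b, ∀ i j, i ≠ j → 0 ≤ B t i j)
    (hint : ∀ i j, IntervalIntegrable (fun t => B t i j) volume a b)
    (hε : 0 < ε) {z : ι → ℝ → ℝ}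
    (hz : ∀ i t, z i t = x t i + ε * ((∫ u in a..t, sumAbs (B u)) + (t - a)))
    (hzc : ∀ i, ContinuousOn (z i) (Set.Icc a b))
    (ht : t ∈ Set.Icc a b) {i : ι} (hmin : ∀ j, ∀ u ∈ Set.Icc a b, z i t ≤ z j u) : t = a := by
  by_contra hne
  have hat : a < t := lt_of_le_of_ne ht.1 (Ne.symm hne)
  obtain ⟨s, hs, hclose⟩ : ∃ s ∈ Set.Ico a t, ∀ u ∈ Set.Icc s t, z i u < z i t + ε := by
    have hleft : Tendsto (z i) (𝓝[≤] t) (𝓝 (z i t)) :=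
      (((hzc i).mono (Set.Icc_subset_Icc_right ht.2)).continuousWithinAt
        (Set.right_mem_Icc.2 ht.1)).tendsto.mono_left (nhdsWithin_Icc_eq_nhdsLE hat).ge
    obtain ⟨l, hl, hsub⟩ := (mem_nhdsLE_iff_exists_mem_Ico_Ioc_subset hat).1
      (hleft.eventually (gt_mem_nhds (lt_add_of_pos_right _ hε)))
    obtain ⟨s, hls, hst⟩ := exists_between hl.2
    exact ⟨s, ⟨hl.1.trans hls.le, hst⟩, fun u hu => hsub ⟨hls.trans_le hu.1, hu.2⟩⟩
  have hpull := hx.neg_mul_integral_sumAbs_le hB hint hs.1 hs.2.le ht.2 hε.le (i := i)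
    fun u hu j => by
      have := hclose u hu
      have := hmin j u ⟨hs.1.trans hu.1, hu.2.trans ht.2⟩
      simp only [hz] at *
      linarith
  have hsplit : (∫ u in a..s, sumAbs (B u)) + ∫ u in s..t, sumAbs (B u) =
      ∫ u in a..t, sumAbs (B u) := by
    have hsub : Set.uIcc a t ⊆ Set.uIcc a b := Set.uIcc_subset_uIcc Set.left_mem_uIcc
      (Set.Icc_subset_uIcc ht)
    have hG := (intervalIntegrable_sumAbs hint).mono_set hsub
    have hs' : s ∈ Set.uIcc a t := Set.Icc_subset_uIcc ⟨hs.1, hs.2.le⟩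
    exact intervalIntegral.integral_add_adjacent_intervals
      (hG.mono_set (Set.uIcc_subset_uIcc Set.left_mem_uIcc hs'))
      (hG.mono_set (Set.uIcc_subset_uIcc hs' Set.right_mem_uIcc))
  have hzs := hmin i s ⟨hs.1, hs.2.le.trans ht.2⟩
  simp only [hz] at hzs
  nlinarith [hs.2, mul_pos hε (sub_pos.2 hs.2)]

theorem le_add_mul (hx : IsSupersolution B a b x)
    (hB : ∀ t ∈ Set.Icc a b, ∀ i j, i ≠ j → 0 ≤ B t i j)
    (hint : ∀ i j, IntervalIntegrable (fun t => B t i j) volume a b) (hab : a ≤ b)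
    (hε : 0 < ε) (hc : ∀ i, c ≤ x a i) (i : ι) :
    c ≤ x b i + ε * ((∫ u in a..b, sumAbs (B u)) + (b - a)) := by
  let z : ι → ℝ → ℝ := fun i t => x t i + ε * ((∫ u in a..t, sumAbs (B u)) + (t - a))
  have hzc (j : ι) : ContinuousOn (z j) (Set.Icc a b) := by
    have hG := intervalIntegral.continuousOn_primitive_interval' (intervalIntegrable_sumAbs hint)
      Set.left_mem_uIcc
    rw [Set.uIcc_of_le hab] at hG
    exact (continuousOn_pi.1 hx.continuousOn j).add
      ((hG.add (continuousOn_id.sub continuousOn_const)).const_mul ε)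
  choose t ht htmin using fun j =>
    isCompact_Icc.exists_isMinOn (Set.nonempty_Icc.2 hab) (hzc j)
  obtain ⟨k, hk⟩ := @Finite.exists_min _ _ _ ⟨i⟩ _ fun j => z j (t j)
  have hmin (j : ι) (u : ℝ) (hu : u ∈ Set.Icc a b) : z k (t k) ≤ z j u :=
    (hk j).trans (isMinOn_iff.1 (htmin j) u hu)
  have htk : t k = a := hx.eq_left_of_isMin hB hint hε (fun _ _ => rfl) hzc (ht k) hmin
  calc c ≤ z k (t k) := by simpa [z, htk] using hc k
    _ ≤ z i b := hmin i b (Set.right_mem_Icc.2 hab)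

theorem le_of_initial_le (hx : IsSupersolution B a b x)
    (hB : ∀ t ∈ Set.Icc a b, ∀ i j, i ≠ j → 0 ≤ B t i j)
    (hint : ∀ i j, IntervalIntegrable (fun t => B t i j) volume a b) (hab : a ≤ b)
    (hc : ∀ i, c ≤ x a i) (i : ι) : c ≤ x b i := by
  have hlim : Tendsto (fun ε => x b i + ε * ((∫ u in a..b, sumAbs (B u)) + (b - a))) (𝓝[>] 0)
      (𝓝 (x b i)) := by
    have hcont : Continuous fun ε => x b i + ε * ((∫ u in a..b, sumAbs (B u)) + (b - a)) := by
      fun_prop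
    simpa using (hcont.tendsto 0).mono_left nhdsWithin_le_nhds
  exact ge_of_tendsto hlim (eventually_nhdsWithin_of_forall fun ε hε =>
    hx.le_add_mul hB hint hab hε hc i)

end IsSupersolution

end MinimumPrinciple

section ConsensusDynamics

open scoped Matrix

/-- The total weight with which the nodes outside `K` act on the nodes of `K`. -/
def inflow {ι : Type*} [Fintype ι] [DecidableEq ι] (M : Matrix ι ι ℝ) (K : Finset ι) : ℝ :=
  ∑ i ∈ K, ∑ j ∈ Kᶜ, M i j

theorem sum_coe_le_sum_add_inflow {ι : Type*} [Fintype ι] [DecidableEq ι] {M : Matrix ι ι ℝ}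
    (hM : ∀ i j, i ≠ j → 0 ≤ M i j) {y : ι → ℝ} (h0 : ∀ i, 0 ≤ y i) (h1 : ∀ i, y i ≤ 1)
    {K : Finset ι} {i : ι} (hi : i ∈ K) :
    ∑ j : K, M i j * (y j - y i) ≤ ∑ j, M i j * (y j - y i) + inflow M K := by
  have hout {k j : ι} (hk : k ∈ K) (hj : j ∈ Kᶜ) : 0 ≤ M k j :=
    hM k j (ne_of_mem_of_not_mem hk (Finset.mem_compl.1 hj))
  have hpull : -∑ j ∈ Kᶜ, M i j * (y j - y i) ≤ ∑ j ∈ Kᶜ, M i j := by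
    rw [← Finset.sum_neg_distrib]
    exact Finset.sum_le_sum fun j hj => by nlinarith [hout hi hj, h0 j, h1 i]
  have hrow : ∑ j ∈ Kᶜ, M i j ≤ inflow M K :=
    Finset.single_le_sum (f := fun k => ∑ j ∈ Kᶜ, M k j)
      (fun k hk => Finset.sum_nonneg fun j hj => hout hk hj) hi
  rw [Finset.sum_coe_sort K fun j => M i j * (y j - y i),
    ← Finset.sum_add_sum_compl K fun j => M i j * (y j - y i)]
  linarith

theorem integrableOn_inflow {ι : Type*} [Fintype ι] [DecidableEq ι] {B : ℝ → Matrix ι ι ℝ}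
    {K : Finset ι} {S : Set ℝ} (hB : ∀ i ∈ K, ∀ j ∉ K, IntegrableOn (fun t => B t i j) S) :
    IntegrableOn (fun t => inflow (B t) K) S :=
  integrable_finsetSum _ fun i hi => integrable_finsetSum _ fun j hj =>
    hB i hi j (Finset.mem_compl.1 hj)

namespace IsTimeChain

variable {N : ℕ} {A : ℝ → Matrix (Fin N) (Fin N) ℝ} {τ t c : ℝ} {v : Fin N → ℝ} {i : Fin N}

theorem intervalIntegrable (hA : IsTimeChain A) (hτ : 0 ≤ τ) (hτt : τ ≤ t) (i j : Fin N) :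
    IntervalIntegrable (fun t => A t i j) volume τ t :=
  intervalIntegrable_of_locallyIntegrableOn_Ici (hA.locallyIntegrable i j) hτ (hτ.trans hτt)

theorem intervalIntegrable_inflow (hA : IsTimeChain A) (hτ : 0 ≤ τ) (hτt : τ ≤ t)
    (K : Finset (Fin N)) : IntervalIntegrable (fun t => inflow (A t) K) volume τ t :=
  ⟨integrableOn_inflow fun i _ j _ => (hA.intervalIntegrable hτ hτt i j).1,
    integrableOn_inflow fun i _ j _ => (hA.intervalIntegrable hτ hτt i j).2⟩

theorem continuousOn_transition_mulVec (hA : IsTimeChain A) (hτ : 0 ≤ τ) (hτt : τ ≤ t)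
    (v : Fin N → ℝ) : ContinuousOn (fun u => transition A u τ *ᵥ v) (Set.Icc τ t) := by
  rw [← Set.uIcc_of_le hτt]
  exact OpinionNetwork.continuousOn_transition_mulVec
    (intervalIntegrable_toOperator (hA.intervalIntegrable hτ hτt)) Set.left_mem_uIcc v

theorem transition_mulVec_sub (hA : IsTimeChain A) (hτ : 0 ≤ τ) {r s : ℝ} (hτr : τ ≤ r)
    (hrs : r ≤ s) (v : Fin N → ℝ) (i : Fin N) :
    (transition A s τ *ᵥ v) i - (transition A r τ *ᵥ v) i =
      ∫ u in r..s, ∑ j, A u i j * ((transition A u τ *ᵥ v) j - (transition A u τ *ᵥ v) i) := by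
  rw [OpinionNetwork.transition_mulVec_sub (intervalIntegrable_toOperator
    (hA.intervalIntegrable hτ (hτr.trans hrs))) (Set.Icc_subset_uIcc ⟨hτr, hrs⟩)
    Set.right_mem_uIcc Set.left_mem_uIcc]
  refine intervalIntegral.integral_congr fun u hu => ?_
  rw [Set.uIcc_of_le hrs] at hu
  simp only [mul_sub, Finset.sum_sub_distrib, ← Finset.sum_mul,
    hA.row_sum u (hτ.trans (hτr.trans hu.1)), zero_mul, sub_zero]

theorem isSupersolution_transition (hA : IsTimeChain A) (hτ : 0 ≤ τ) (hτt : τ ≤ t)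
    (v : Fin N → ℝ) : IsSupersolution A τ t fun u => transition A u τ *ᵥ v where
  continuousOn := hA.continuousOn_transition_mulVec hτ hτt v
  integral_le i _ _ hr hrs _ := (hA.transition_mulVec_sub hτ hr hrs v i).ge

theorem le_transition_mulVec (hA : IsTimeChain A) (hτ : 0 ≤ τ) (hτt : τ ≤ t)
    (hv : ∀ i, c ≤ v i) (i : Fin N) : c ≤ (transition A t τ *ᵥ v) i :=
  (hA.isSupersolution_transition hτ hτt v).le_of_initial_le
    (fun u hu => hA.offDiag_nonneg u (hτ.trans hu.1)) (hA.intervalIntegrable hτ hτt) hτt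
    (by simpa only [transition_self, Matrix.one_mulVec] using hv) i

theorem transition_mulVec_le (hA : IsTimeChain A) (hτ : 0 ≤ τ) (hτt : τ ≤ t)
    (hv : ∀ i, v i ≤ c) (i : Fin N) : (transition A t τ *ᵥ v) i ≤ c := by
  have h := hA.le_transition_mulVec hτ hτt (c := -c) (v := -v) (fun i => neg_le_neg (hv i)) i
  rw [Matrix.mulVec_neg, Pi.neg_apply] at h
  exact neg_le_neg_iff.1 h

/-- Nodes outside `K` have opinions at least `0`, so relative to the opinions in `K`, which are at
most `1`, they pull down at a rate of at most the inflow; adding the accumulated inflow turns the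
opinions in `K` into a supersolution of the dynamics within `K`. -/
theorem isSupersolution_submatrix (hA : IsTimeChain A) (hτ : 0 ≤ τ) (hτt : τ ≤ t)
    (h0 : ∀ i, 0 ≤ v i) (h1 : ∀ i, v i ≤ 1) (K : Finset (Fin N)) :
    IsSupersolution (fun u => (A u).submatrix ((↑) : K → Fin N) (↑)) τ t
      fun u k => (transition A u τ *ᵥ v) k + ∫ s in τ..u, inflow (A s) K where
  continuousOn := by
    have hinflow := intervalIntegral.continuousOn_primitive_interval'
      (hA.intervalIntegrable_inflow hτ hτt K) Set.left_mem_uIcc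
    rw [Set.uIcc_of_le hτt] at hinflow
    exact continuousOn_pi.2 fun k =>
      (continuousOn_pi.1 (hA.continuousOn_transition_mulVec hτ hτt v) k).add hinflow
  integral_le k r s hr hrs hs := by
    have hr0 : 0 ≤ r := hτ.trans hr
    have hy (k : Fin N) : ContinuousOn (fun u => (transition A u τ *ᵥ v) k) (Set.uIcc r s) := by
      rw [Set.uIcc_of_le hrs]
      exact (continuousOn_pi.1 (hA.continuousOn_transition_mulVec hτ hτt v) k).mono
        (Set.Icc_subset_Icc hr hs)
    have hterm (k l : Fin N) : IntervalIntegrable (fun u => A u k l *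
        ((transition A u τ *ᵥ v) l - (transition A u τ *ᵥ v) k)) volume r s :=
      (hA.intervalIntegrable hr0 hrs k l).mul_continuousOn ((hy l).sub (hy k))
    have hsum := IntervalIntegrable.sum Finset.univ fun j _ => hterm k j
    have hsumK := IntervalIntegrable.sum Finset.univ fun (l : K) _ => hterm k l
    rw [Finset.sum_fn] at hsum hsumK
    have hinflow := hA.intervalIntegrable_inflow hr0 hrs K
    simp only [Matrix.submatrix_apply, add_sub_add_right_eq_sub]
    rw [add_sub_add_comm, hA.transition_mulVec_sub hτ hr hrs,
      intervalIntegral.integral_interval_sub_left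
        (hA.intervalIntegrable_inflow hτ (hr.trans hrs) K) (hA.intervalIntegrable_inflow hτ hr K),
      ← intervalIntegral.integral_add hsum hinflow]
    exact intervalIntegral.integral_mono_on hrs hsumK (hsum.add hinflow) fun u hu =>
      have hτu := hr.trans hu.1
      sum_coe_le_sum_add_inflow (hA.offDiag_nonneg u (hτ.trans hτu))
        (hA.le_transition_mulVec hτ hτu h0) (hA.transition_mulVec_le hτ hτu h1) k.2

theorem sub_integral_inflow_le (hA : IsTimeChain A) (hτ : 0 ≤ τ) (hτt : τ ≤ t)
    (h0 : ∀ i, 0 ≤ v i) (h1 : ∀ i, v i ≤ 1) {K : Finset (Fin N)} (hc : ∀ i ∈ K, c ≤ v i)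
    (hi : i ∈ K) : c - ∫ s in τ..t, inflow (A s) K ≤ (transition A t τ *ᵥ v) i := by
  rw [sub_le_iff_le_add]
  refine (hA.isSupersolution_submatrix hτ hτt h0 h1 K).le_of_initial_le
    (fun u hu k l hkl => hA.offDiag_nonneg u (hτ.trans hu.1) k l (Subtype.coe_ne_coe.2 hkl))
    (fun k l => hA.intervalIntegrable hτ hτt k l) hτt (fun k => ?_) ⟨i, hi⟩
  simpa only [transition_self, Matrix.one_mulVec, intervalIntegral.integral_same, add_zero]
    using hc k k.2

end IsTimeChain

end ConsensusDynamics

section PredecessorClosed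

/-- No edge of `H` enters `K` from outside. In the unbounded interactions graph these are the sets
of nodes that in total receive only a finite amount of influence from the other nodes. -/
def IsPredClosed {V : Type*} (H : Digraph V) (K : Finset V) : Prop :=
  ∀ ⦃i j : V⦄, H.Adj i j → j ∈ K → i ∈ K

variable {N : ℕ} {A : ℝ → Matrix (Fin N) (Fin N) ℝ}

theorem IsTimeChain.integrableOn_of_not_adj (hA : IsTimeChain A) {i j : Fin N} (hij : i ≠ j)
    (h : ¬(unboundedInteractions A).Adj i j) :
    IntegrableOn (fun t => A t j i) (Set.Ici 0) := by
  have hfin : ∫⁻ t in Set.Ici (0 : ℝ), ENNReal.ofReal (A t j i) ≠ ⊤ := fun htop => h ⟨hij, htop⟩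
  rwa [lintegral_ofReal_ne_top_iff_integrable
    (hA.locallyIntegrable j i).aestronglyMeasurable] at hfin
  filter_upwards [self_mem_ae_restrict measurableSet_Ici] with t ht
  exact hA.offDiag_nonneg t ht j i hij.symm

theorem IsTimeChain.integrableOn_inflow (hA : IsTimeChain A) {K : Finset (Fin N)}
    (hK : IsPredClosed (unboundedInteractions A) K) :
    IntegrableOn (fun t => inflow (A t) K) (Set.Ici 0) :=
  OpinionNetwork.integrableOn_inflow fun _ hi _ hj =>
    hA.integrableOn_of_not_adj (ne_of_mem_of_not_mem hi hj).symm fun h => hj (hK h hi)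

end PredecessorClosed

section RankBound

open scoped Matrix

/-- Ahlberg–Nilson–Varah bound: look at the row of an entry of `c` of largest norm. -/
theorem mul_norm_le_norm_mulVec {ι 𝕜 : Type*} [Fintype ι] [DecidableEq ι] [NormedField 𝕜]
    {M : Matrix ι ι 𝕜} {δ : ℝ}
    (hM : ∀ i, δ + ∑ j ∈ Finset.univ.erase i, ‖M i j‖ ≤ ‖M i i‖) (c : ι → 𝕜) :
    δ * ‖c‖ ≤ ‖M *ᵥ c‖ := by
  rcases isEmpty_or_nonempty ι with hι | hι
  · simp [Subsingleton.elim c 0]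
  obtain ⟨i, hi⟩ := Finite.exists_max fun i => ‖c i‖
  have hnorm : ‖c‖ = ‖c i‖ :=
    le_antisymm ((pi_norm_le_iff_of_nonneg (norm_nonneg _)).2 hi) (norm_le_pi_norm c i)
  have hrest : ‖∑ j ∈ Finset.univ.erase i, M i j * c j‖ ≤
      (∑ j ∈ Finset.univ.erase i, ‖M i j‖) * ‖c i‖ := by
    rw [Finset.sum_mul]
    exact norm_sum_le_of_le _ fun j _ => norm_mul_le_of_le le_rfl (hi j)
  calc δ * ‖c‖ ≤ ‖M i i‖ * ‖c i‖ - (∑ j ∈ Finset.univ.erase i, ‖M i j‖) * ‖c i‖ := by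
        rw [hnorm, ← sub_mul]
        exact mul_le_mul_of_nonneg_right (le_sub_iff_add_le.2 (hM i)) (norm_nonneg _)
    _ ≤ ‖M i i * c i‖ - ‖∑ j ∈ Finset.univ.erase i, M i j * c j‖ := by
        rw [norm_mul]
        gcongr
    _ ≤ ‖M i i * c i + ∑ j ∈ Finset.univ.erase i, M i j * c j‖ := norm_sub_le_norm_add _ _
    _ = ‖(M *ᵥ c) i‖ := by
        rw [Finset.add_sum_erase _ (fun j => M i j * c j) (Finset.mem_univ i)]
        rfl
    _ ≤ ‖M *ᵥ c‖ := norm_le_pi_norm _ i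

/-- The linear map sending `c` to the vector with value `c s` on the block `K s`, for disjoint
blocks, and `0` elsewhere. Its range is the space of opinions, constant on each block, that turns
out to meet a null space only in `0`. -/
noncomputable def blockMap {ι V : Type*} [Fintype ι] (K : ι → Finset V) :
    (ι → ℝ) →ₗ[ℝ] (V → ℝ) :=
  Fintype.linearCombination ℝ fun s => Set.indicator (K s) 1

theorem sum_indicator_le_one {ι V : Type*} [Fintype ι] {K : ι → Finset V}
    (hK : Pairwise (Function.onFun Disjoint K)) (j : V) :
    ∑ s, Set.indicator (K s) (1 : V → ℝ) j ≤ 1 := by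
  have hdisj : (Set.univ : Set ι).PairwiseDisjoint fun s => (K s : Set V) := fun s _ r _ hne =>
    Finset.disjoint_coe.2 (hK hne)
  have hunion := congrFun (Finset.indicator_biUnion (f := (1 : V → ℝ)) Finset.univ
    (fun s => (K s : Set V)) (by simpa using hdisj)) j
  rw [← hunion]
  exact Set.indicator_le' (fun _ _ => le_rfl) (fun _ _ => zero_le_one) j

variable {N : ℕ} {A : ℝ → Matrix (Fin N) (Fin N) ℝ} {τ t : ℝ} {ι : Type*} [Fintype ι]
  {K : ι → Finset (Fin N)}

/-- Reading the trajectories of the block indicators off at one node per block gives a strictly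
diagonally dominant matrix: its row sums are at most `1`, its diagonal entries at least `3 / 4`. -/
theorem IsTimeChain.half_norm_le_norm_transition_blockMap (hA : IsTimeChain A) (hτ : 0 ≤ τ)
    (hτt : τ ≤ t) (hne : ∀ s, (K s).Nonempty) (hdisj : Pairwise (Function.onFun Disjoint K))
    (hinflow : ∀ s, ∫ u in τ..t, inflow (A u) (K s) ≤ 1 / 4) (c : ι → ℝ) :
    1 / 2 * ‖c‖ ≤ ‖transition A t τ *ᵥ blockMap K c‖ := by
  classical
  choose k hk using hne
  let χ : ι → Fin N → ℝ := fun s => Set.indicator (K s) 1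
  have hχ0 (s : ι) (j : Fin N) : 0 ≤ χ s j := Set.indicator_nonneg (fun _ _ => zero_le_one) j
  have hχ1 (s : ι) (j : Fin N) : χ s j ≤ 1 :=
    Set.indicator_le' (fun _ _ => le_rfl) (fun _ _ => zero_le_one) j
  let M : Matrix ι ι ℝ := .of fun r s => (transition A t τ *ᵥ χ s) (k r)
  have hM0 (r s : ι) : 0 ≤ M r s := hA.le_transition_mulVec hτ hτt (hχ0 s) (k r)
  have hdiag (r : ι) : 3 / 4 ≤ M r r := by
    have hleak : 1 - ∫ u in τ..t, inflow (A u) (K r) ≤ M r r :=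
      hA.sub_integral_inflow_le hτ hτt (hχ0 r) (hχ1 r)
        (fun i hi => (Set.indicator_of_mem (Finset.mem_coe.2 hi) 1).ge) (hk r)
    linarith [hinflow r]
  have hrow (r : ι) : ∑ s, M r s ≤ 1 := by
    have h := hA.transition_mulVec_le hτ hτt (v := ∑ s, χ s) (c := 1)
      (fun j => by simpa only [Finset.sum_apply] using sum_indicator_le_one hdisj j) (k r)
    rwa [Matrix.mulVec_sum, Finset.sum_apply] at h
  have hdom (r : ι) : 1 / 2 + ∑ s ∈ Finset.univ.erase r, ‖M r s‖ ≤ ‖M r r‖ := by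
    simp only [Real.norm_of_nonneg (hM0 _ _)]
    linarith [hdiag r, hrow r, Finset.add_sum_erase _ (M r) (Finset.mem_univ r)]
  refine (mul_norm_le_norm_mulVec hdom c).trans
    ((pi_norm_le_iff_of_nonneg (norm_nonneg _)).2 fun r => ?_)
  have hread : (M *ᵥ c) r = (transition A t τ *ᵥ blockMap K c) (k r) := by
    rw [blockMap, Fintype.linearCombination_apply, Matrix.mulVec_sum, Finset.sum_apply]
    exact Finset.sum_congr rfl fun s _ => by
      rw [Matrix.mulVec_smul, Pi.smul_apply, smul_eq_mul, mul_comm]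
      rfl
  rw [hread]
  exact norm_le_pi_norm _ _

theorem IsTimeChain.exists_forall_eq_zero_of_blockMap_mem_nullSpace (hA : IsTimeChain A)
    (hne : ∀ s, (K s).Nonempty) (hdisj : Pairwise (Function.onFun Disjoint K))
    (hclosed : ∀ s, IsPredClosed (unboundedInteractions A) (K s)) :
    ∃ τ, 0 ≤ τ ∧ ∀ c, blockMap K c ∈ nullSpace A τ → c = 0 := by
  obtain ⟨τ, htail, hτ⟩ : ∃ τ : ℝ,
      (∀ s, ∀ t, τ ≤ t → ‖∫ u in τ..t, inflow (A u) (K s)‖ ≤ 1 / 4) ∧ 0 ≤ τ :=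
    ((eventually_all.2 fun s => eventually_forall_ge_norm_integral_le
      ((hA.integrableOn_inflow (hclosed s)).mono_set Set.Ioi_subset_Ici_self)
      (by norm_num)).and (eventually_ge_atTop 0)).exists
  refine ⟨τ, hτ, fun c hc => norm_le_zero_iff.1 ?_⟩
  have hlim : Tendsto (fun t => ‖transition A t τ *ᵥ blockMap K c‖) atTop (𝓝 0) := by
    simpa only [norm_zero] using Tendsto.norm hc
  have hlow : 1 / 2 * ‖c‖ ≤ 0 := ge_of_tendsto hlim <| (eventually_ge_atTop τ).mono fun t ht =>
    hA.half_norm_le_norm_transition_blockMap hτ ht hne hdisj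
      (fun s => (le_abs_self _).trans (htail s t ht)) c
  linarith

theorem IsTimeChain.card_le_rank (hA : IsTimeChain A)
    (hne : ∀ s, (K s).Nonempty) (hdisj : Pairwise (Function.onFun Disjoint K))
    (hclosed : ∀ s, IsPredClosed (unboundedInteractions A) (K s)) :
    Fintype.card ι ≤ rank A := by
  obtain ⟨τ, hτ, hzero⟩ := hA.exists_forall_eq_zero_of_blockMap_mem_nullSpace hne hdisj hclosed
  have hinj : Function.Injective (blockMap K) := (injective_iff_map_eq_zero _).2 fun c hc =>
    hzero c (hc ▸ Submodule.zero_mem _)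
  have hrange : Disjoint (LinearMap.range (blockMap K)) (nullSpace A τ) := by
    rw [Submodule.disjoint_def]
    rintro _ ⟨c, rfl⟩ hc
    rw [hzero c hc, map_zero]
  have hdim := Submodule.finrank_add_finrank_le_of_disjoint hrange
  rw [LinearMap.finrank_range_of_inj hinj, finrank_nullSpace_eq hA.locallyIntegrable le_rfl hτ,
    Module.finrank_fintype_fun_eq_card, Module.finrank_fin_fun] at hdim
  exact Nat.le_sub_of_add_le hdim

end RankBound

section SRoots

variable {V : Type*} {H : Digraph V} {S T : Finset V}

theorem isSRoot_iff : IsSRoot H S ↔ ∀ i, ∃ j ∈ S, Relation.ReflTransGen H.Adj j i := by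
  refine forall_congr' fun i => ⟨?_, fun ⟨j, hj, hji⟩ => ?_⟩
  · rintro (hi | ⟨j, hj, hji⟩)
    exacts [⟨i, hi, .refl⟩, ⟨j, hj, hji.to_reflTransGen⟩]
  · rcases Relation.reflTransGen_iff_eq_or_transGen.1 hji with rfl | h
    exacts [.inl hj, .inr ⟨j, hj, h⟩]

theorem IsSRoot.of_forall_reachable (hS : IsSRoot H S)
    (hT : ∀ s ∈ S, ∃ j ∈ T, Relation.ReflTransGen H.Adj j s) : IsSRoot H T :=
  isSRoot_iff.2 fun i => by
    obtain ⟨s, hs, hsi⟩ := isSRoot_iff.1 hS i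
    obtain ⟨j, hj, hjs⟩ := hT s hs
    exact ⟨j, hj, hjs.trans hsi⟩

theorem IsSRoot.minSRootSize_le (hS : IsSRoot H S) : minSRootSize H ≤ S.card :=
  Nat.sInf_le ⟨S, hS, rfl⟩

open scoped Classical in
/-- The nodes from which `r` can be reached, `r` included. -/
noncomputable def ancestors [Fintype V] (H : Digraph V) (r : V) : Finset V :=
  {j | Relation.ReflTransGen H.Adj j r}

theorem mem_ancestors [Fintype V] {j r : V} :
    j ∈ ancestors H r ↔ Relation.ReflTransGen H.Adj j r := by
  simp only [ancestors, Finset.mem_filter_univ]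

theorem isPredClosed_ancestors [Fintype V] (H : Digraph V) (r : V) :
    IsPredClosed H (ancestors H r) := fun _ _ hij hj =>
  mem_ancestors.2 (.head hij (mem_ancestors.1 hj))

/-- Two members of an s-root with a common ancestor could be replaced by that ancestor. -/
theorem IsSRoot.pairwiseDisjoint_ancestors [Fintype V] (hS : IsSRoot H S)
    (hmin : S.card = minSRootSize H) : (S : Set V).PairwiseDisjoint (ancestors H) := by
  classical
  intro r hr r' hr' hne
  refine Finset.disjoint_left.2 fun j hj hj' => ?_
  rw [mem_ancestors] at hj hj'
  have hroot : IsSRoot H (insert j ((S.erase r).erase r')) := hS.of_forall_reachable fun s hs => by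
    by_cases h : s = r ∨ s = r'
    · exact ⟨j, Finset.mem_insert_self _ _, by rcases h with rfl | rfl <;> assumption⟩
    · exact ⟨s, by grind, .refl⟩
  have hle := hroot.minSRootSize_le.trans (Finset.card_insert_le _ _)
  have hcard := Finset.card_erase_add_one hr
  have hcard' := Finset.card_erase_add_one (Finset.mem_erase.2 ⟨hne.symm, hr'⟩)
  omega

end SRoots

end OpinionNetwork

theorem theorem3 (N : ℕ) (A : ℝ → Matrix (Fin N) (Fin N) ℝ)
    (hA : OpinionNetwork.IsTimeChain A) :
    (∀ τ : ℝ, 0 ≤ τ →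
      Module.finrank ℝ (OpinionNetwork.nullSpace A τ) = OpinionNetwork.nullity A) ∧
    OpinionNetwork.minSRootSize (OpinionNetwork.unboundedInteractions A) ≤
      OpinionNetwork.rank A := by
  refine ⟨fun τ hτ =>
    OpinionNetwork.finrank_nullSpace_eq hA.locallyIntegrable le_rfl hτ, ?_⟩
  obtain ⟨S, hS, hmin⟩ :=
    OpinionNetwork.exists_isSRoot_card_eq (OpinionNetwork.unboundedInteractions A)
  have hdisj := hS.pairwiseDisjoint_ancestors hmin
  rw [← hmin, ← Fintype.card_coe S]
  exact hA.card_le_rank (K := fun s : S => OpinionNetwork.ancestors _ s)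
    (fun s => ⟨s, OpinionNetwork.mem_ancestors.2 .refl⟩)
    (fun r s hrs => hdisj r.2 s.2 (Subtype.coe_ne_coe.2 hrs))
    fun s => OpinionNetwork.isPredClosed_ancestors _ s.1
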